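/- Let $m \neq \pm 1$ be a square-free rational integer such that $x^{12}-m$ is irreducible in $\mathbb{Z}[x]$, let $\alpha\in\mathbb{C}$ be a root of $x^{12}-m$, and let $K=\mathbb{Q}(\alpha)$, with ring of integers $\mathbb{Z}_K$. If $m\equiv 1 \pmod 4$ or $m\equiv \pm 1\pmod 9$, then $K$ is not monogenic; that is, there is no $\theta\in\mathbb{Z}_K$ for which the index $(\mathbb{Z}_K:\mathbb{Z}[\theta])$ equals $1$. -/

import Mathlib

open scoped IntermediateField

/-- The index `(ℤ_K : ℤ[θ])` of the subring `ℤ[θ]` generated by `θ` in the ring of integers `ℤ_K`,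
as a subgroup of the additive group of `ℤ_K` (with value `0` when the index is infinite). -/
noncomputable def integralIndex (K : Type*) [Field K] (θ : NumberField.RingOfIntegers K) : ℕ :=
  (Algebra.adjoin ℤ {θ}).toSubring.toAddSubgroup.index

/-- `K` is monogenic: some `θ` in the ring of integers satisfies `(ℤ_K : ℤ[θ]) = 1`. -/
def IsMonogenicField (K : Type*) [Field K] : Prop :=
  ∃ θ : NumberField.RingOfIntegers K, integralIndex K θ = 1

theorem isMonogenicField_iff_adjoin (K : Type*) [Field K] :
    IsMonogenicField K ↔
      ∃ θ : NumberField.RingOfIntegers K, Algebra.adjoin ℤ {θ} = ⊤ := by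
  refine exists_congr fun θ => ?_
  rw [integralIndex, AddSubgroup.index_eq_one, AddSubgroup.eq_top_iff', Algebra.eq_top_iff]
  exact Iff.rfl

/-! If `𝓞 K = ℤ[θ]`, a homomorphism from `𝓞 K` to a finite field `k` is determined by its value at
`θ` (`ringHom_ext_of_adjoin_eq_top`), so `k` bounds the number of such homomorphisms. Moreover, if
that value is fixed by Frobenius, so is the whole homomorphism. At 2 (for `m ≡ 1 mod 4`) and at 3
(for `m ≡ ±1 mod 9`) there are too many homomorphisms.

They arise by sending `α` to a 12th root of `m` in `W(k)[1/p]` or a ramified quadratic extension of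
it. Algebraic integers land in `W(k)` or in its Eisenstein extension, which are then reduced to `k`.
Those agreeing on `α` are told apart by an extra integer `e`.

At 2, `e = (1 + α^6)/2` and `k = F_4`: `exists_residue_hom_two` gives two homomorphisms sending `α`
to the same `w ∉ F_2`, neither equal nor Frobenius conjugate, while `F_4 \ F_2` is a single
Frobenius orbit. At 3, write `m = ε(1 + 9t)` with `ε = ±1` and `e = (1 + ε α^4 + α^8)/3`: by
`exists_residue_homs_three` each `y` with `y^4 = ε` carries two homomorphisms. For `ε = 1` this
gives 4 > 3 over `F_3`; for `ε = -1`, at least 8 values in `F_9 \ F_3`, which has 6 elements. -/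

open scoped IntermediateField

open NumberField Polynomial

/-! ### Homomorphisms out of a pure field and its ring of integers -/

/-- A ring homomorphism from `K` to `B` restricts to `𝓞 K → A` when `A ⊆ B` contains all elements
of `B` that are integral over `ℤ`. -/
theorem exists_ringOfIntegers_lift {K A B : Type*} [Field K] [CommRing A] [CommRing B]
    (ι : A →+* B) (hι : Function.Injective ι) (hint : ∀ b : B, IsIntegral ℤ b → b ∈ ι.range)
    (ψ : K →+* B) : ∃ φ : 𝓞 K →+* A, ∀ x : 𝓞 K, ι (φ x) = ψ x := by
  have h (x : 𝓞 K) : ψ x ∈ ι.range :=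
    hint _ (map_isIntegral_int ψ (RingOfIntegers.isIntegral_coe x))
  let e : A ≃+* ι.range := RingEquiv.ofBijective ι.rangeRestrict
    ⟨fun x y hxy => hι (congrArg Subtype.val hxy), ι.rangeRestrict_surjective⟩
  let ψ' : 𝓞 K →+* ι.range := (ψ.comp (algebraMap (𝓞 K) K)).codRestrict ι.range h
  refine ⟨e.symm.toRingHom.comp ψ', fun x => ?_⟩
  exact congrArg Subtype.val (e.apply_symm_apply (ψ' x))

theorem exists_pureField_hom {n : ℕ} (hn : n ≠ 0) {m : ℤ}
    (hirr : Irreducible (X ^ n - C m : ℤ[X])) {α : ℂ} (hα : α ^ n = (m : ℂ))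
    {B : Type*} [CommRing B] [Algebra ℚ B] {β : B} (hβ : β ^ n = (m : B)) :
    ∃ ψ : ℚ⟮α⟯ →+* B, ψ (IntermediateField.AdjoinSimple.gen ℚ α) = β := by
  have hmonic : (X ^ n - C m : ℤ[X]).Monic := monic_X_pow_sub_C m hn
  have hirr' : Irreducible (X ^ n - C (m : ℚ) : ℚ[X]) := by
    simpa using (hmonic.irreducible_iff_irreducible_map_fraction_map (K := ℚ)).1 hirr
  have hmin : minpoly ℚ α = X ^ n - C (m : ℚ) :=
    (minpoly.eq_of_irreducible_of_monic hirr' (by simp [hα, -map_intCast])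
      (monic_X_pow_sub_C _ hn)).symm
  have hαint : IsIntegral ℚ α := ⟨_, monic_X_pow_sub_C (m : ℚ) hn, by
    rw [eval₂_sub, eval₂_X_pow, eval₂_C]; simp [hα]⟩
  let pb := IntermediateField.adjoin.powerBasis hαint
  have hgen : pb.gen = IntermediateField.AdjoinSimple.gen ℚ α :=
    IntermediateField.adjoin.powerBasis_gen hαint
  refine ⟨(pb.lift β ?_).toRingHom, ?_⟩
  · rw [hgen, IntermediateField.minpoly_gen, hmin]
    simp [hβ]
  · exact (congrArg _ hgen.symm).trans (pb.lift_gen β _)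

theorem pureField_gen_pow {n : ℕ} {m : ℤ} {α : ℂ} (hα : α ^ n = (m : ℂ)) :
    (IntermediateField.AdjoinSimple.gen ℚ α) ^ n = (m : ℚ⟮α⟯) := by
  apply Subtype.ext
  simp [hα]

/-- The generator of a pure field, as an algebraic integer. -/
theorem exists_pureField_int {n : ℕ} (hn : n ≠ 0) {m : ℤ} {α : ℂ} (hα : α ^ n = (m : ℂ)) :
    ∃ a : 𝓞 ℚ⟮α⟯, (a : ℚ⟮α⟯) = IntermediateField.AdjoinSimple.gen ℚ α ∧ a ^ n = (m : 𝓞 ℚ⟮α⟯) := by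
  have h := pureField_gen_pow hα
  refine ⟨⟨IntermediateField.AdjoinSimple.gen ℚ α,
    ⟨X ^ n - C m, monic_X_pow_sub_C m hn, by rw [eval₂_sub, eval₂_X_pow, eval₂_C]; simp [h]⟩⟩, rfl, ?_⟩
  apply RingOfIntegers.ext
  exact (map_pow (algebraMap (𝓞 ℚ⟮α⟯) ℚ⟮α⟯) _ n).trans
    (h.trans (map_intCast (algebraMap (𝓞 ℚ⟮α⟯) ℚ⟮α⟯) m).symm)

theorem exists_pureField_int_hom {n : ℕ} (hn : n ≠ 0) {m : ℤ}
    (hirr : Irreducible (X ^ n - C m : ℤ[X])) {α : ℂ} (hα : α ^ n = (m : ℂ))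
    {A B : Type*} [CommRing A] [CommRing B] [Algebra ℚ B]
    (ι : A →+* B) (hι : Function.Injective ι) (hint : ∀ b : B, IsIntegral ℤ b → b ∈ ι.range)
    {β : A} (hβ : β ^ n = (m : A)) {a : 𝓞 ℚ⟮α⟯}
    (ha : (a : ℚ⟮α⟯) = IntermediateField.AdjoinSimple.gen ℚ α) :
    ∃ φ : 𝓞 ℚ⟮α⟯ →+* A, φ a = β := by
  obtain ⟨ψ, hψ⟩ := exists_pureField_hom hn hirr hα (β := ι β) (by rw [← map_pow, hβ, map_intCast])
  obtain ⟨φ, hφ⟩ := exists_ringOfIntegers_lift ι hι hint ψ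
  exact ⟨φ, hι (by rw [hφ, ha, hψ])⟩

theorem mem_range_algebraMap_of_isIntegral_int {R F : Type*} [CommRing R] [IsDomain R]
    [IsIntegrallyClosed R] [Field F] [Algebra R F] [IsFractionRing R F] {x : F}
    (hx : IsIntegral ℤ x) : x ∈ (algebraMap R F).range :=
  IsIntegrallyClosed.isIntegral_iff.1 (hx.tower_top (A := R))

/-! ### Eisenstein quadratic extensions and their integral elements -/

section Quadratic

variable {R : Type*} [CommRing R] {a b : R}

/-- The reduction `x + y ω ↦ ρ x` when `a` reduces to zero. -/
def quadraticResidue {k : Type*} [CommRing k] (ρ : R →+* k) (ha : ρ a = 0) :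
    QuadraticAlgebra R a b →+* k where
  toFun z := ρ z.re
  map_one' := by simp [QuadraticAlgebra.re_one]
  map_mul' z w := by simp [ha]
  map_zero' := by simp
  map_add' z w := by simp

theorem quadraticResidue_algebraMap {k : Type*} [CommRing k] (ρ : R →+* k) (ha : ρ a = 0) (x : R) :
    quadraticResidue (b := b) ρ ha (algebraMap R _ x) = ρ x := rfl

theorem quadraticResidue_omega {k : Type*} [CommRing k] (ρ : R →+* k) (ha : ρ a = 0) :
    quadraticResidue (b := b) ρ ha QuadraticAlgebra.omega = 0 := map_zero ρ

/-- Coefficientwise extension of the algebra map to quadratic algebras. -/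
def quadraticMap (F : Type*) [CommRing F] [Algebra R F] :
    QuadraticAlgebra R a b →+* QuadraticAlgebra F (algebraMap R F a) (algebraMap R F b) where
  toFun z := ⟨algebraMap R F z.re, algebraMap R F z.im⟩
  map_one' := by ext <;> simp [QuadraticAlgebra.re_one, QuadraticAlgebra.im_one]
  map_mul' z w := by ext <;> simp
  map_zero' := by ext <;> simp
  map_add' z w := by ext <;> simp

theorem quadraticMap_injective {F : Type*} [CommRing F] [Algebra R F]
    (h : Function.Injective (algebraMap R F)) :
    Function.Injective (quadraticMap (a := a) (b := b) F) := by
  intro z w hzw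
  ext
  · exact h (congrArg QuadraticAlgebra.re hzw)
  · exact h (congrArg QuadraticAlgebra.im hzw)

theorem quadratic_natCast_mul_left_cancel [IsDomain R] {n : ℕ} (hn : (n : R) ≠ 0)
    {z w : QuadraticAlgebra R a b} (h : n * z = n * w) : z = w := by
  have hsmul (z : QuadraticAlgebra R a b) : n * z = (n : R) • z := by
    rw [Algebra.smul_def, map_natCast]
  rw [hsmul, hsmul] at h
  ext
  · exact mul_left_cancel₀ hn (congrArg QuadraticAlgebra.re h)
  · exact mul_left_cancel₀ hn (congrArg QuadraticAlgebra.im h)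

/-- Infinite descent on the norm form of `Y² = p b' Y + p q`: divisibility by `p²` forces `p ∣ U`,
then `p ∣ q V²`, hence `p ∣ V`. -/
theorem pow_dvd_of_eisenstein_norm [IsDomain R] {p q b' : R} (hp : Prime p) (hq : ¬ p ∣ q) (n : ℕ) :
    ∀ U V N : R, U ^ 2 + p * b' * U * V - p * q * V ^ 2 = p ^ (2 * n) * N → p ^ n ∣ U ∧ p ^ n ∣ V := by
  induction n with
  | zero => simp
  | succ n ih =>
    intro U V N h
    have hU : p ∣ U := by
      apply hp.dvd_of_dvd_pow (n := 2)
      exact ⟨p ^ (2 * n + 1) * N - b' * U * V + q * V ^ 2, by linear_combination h⟩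
    obtain ⟨U, rfl⟩ := hU
    have hV : p ∣ V := by
      apply hp.dvd_of_dvd_pow (n := 2)
      refine (hp.dvd_or_dvd (?_ : p ∣ q * V ^ 2)).resolve_left hq
      refine ⟨U ^ 2 + b' * U * V - p ^ (2 * n) * N, mul_left_cancel₀ hp.ne_zero ?_⟩
      linear_combination -h
    obtain ⟨V, rfl⟩ := hV
    obtain ⟨⟨U', rfl⟩, ⟨V', rfl⟩⟩ := ih U V N (by
      refine mul_left_cancel₀ (pow_ne_zero 2 hp.ne_zero) ?_
      linear_combination h)
    exact ⟨⟨U', by ring⟩, ⟨V', by ring⟩⟩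

/-- The norm of an integral element lies in `R`. Clearing denominators, which are powers of `p`, and
applying the descent on the norm form shows that both coordinates lie in `R`. -/
theorem mem_range_quadraticMap_of_isIntegral [IsDomain R] [IsIntegrallyClosed R]
    {F : Type*} [Field F] [Algebra R F] [IsFractionRing R F] {p q b' : R} (hp : Prime p)
    (hq : ¬ p ∣ q) (hden : ∀ s : R, s ≠ 0 → ∃ n : ℕ, s ∣ p ^ n) (ha : a = p * q) (hb : b = p * b')
    (z : QuadraticAlgebra F (algebraMap R F a) (algebraMap R F b)) (hz : IsIntegral ℤ z) :
    z ∈ (quadraticMap (a := a) (b := b) F).range := by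
  have hinj := IsFractionRing.injective R F
  have hnorm : ∃ N, algebraMap R F N = z.norm := by
    have h1 : IsIntegral ℤ (algebraMap F (QuadraticAlgebra F (algebraMap R F a) (algebraMap R F b))
        z.norm) := by
      rw [QuadraticAlgebra.algebraMap_norm_eq_mul_star]
      exact hz.mul (map_isIntegral_int (starRingEnd _) hz)
    have h2 : IsIntegral ℤ z.norm :=
      (isIntegral_algHom_iff ((algebraMap F
        (QuadraticAlgebra F (algebraMap R F a) (algebraMap R F b))).toIntAlgHom)
        QuadraticAlgebra.algebraMap_injective).1 h1
    exact mem_range_algebraMap_of_isIntegral_int h2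
  have hfrac (x : F) : ∃ n U, algebraMap R F U = algebraMap R F p ^ n * x := by
    obtain ⟨r, s, hs, rfl⟩ := IsFractionRing.div_surjective (A := R) x
    obtain ⟨n, w, hw⟩ := hden s (nonZeroDivisors.ne_zero hs)
    have hs' : algebraMap R F s ≠ 0 := by
      simpa using (map_ne_zero_iff _ hinj).2 (nonZeroDivisors.ne_zero hs)
    refine ⟨n, w * r, ?_⟩
    rw [← map_pow, hw]
    push_cast [map_mul]
    field_simp
  obtain ⟨N, hN⟩ := hnorm
  obtain ⟨n₁, U, hU⟩ := hfrac z.re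
  obtain ⟨n₂, V, hV⟩ := hfrac z.im
  have hpF : algebraMap R F p ≠ 0 := (map_ne_zero_iff _ hinj).2 hp.ne_zero
  obtain ⟨⟨U', hU'⟩, ⟨V', hV'⟩⟩ := pow_dvd_of_eisenstein_norm (b' := b') hp hq (n₁ + n₂)
    (p ^ n₂ * U) (p ^ n₁ * V) N (by
      apply hinj
      rw [QuadraticAlgebra.norm_def] at hN
      subst ha hb
      simp only [map_sub, map_add, map_mul, map_pow, hU, hV, hN]
      ring)
  refine ⟨⟨U', V'⟩, ?_⟩
  ext
  · change algebraMap R F U' = _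
    have := congrArg (algebraMap R F) hU'
    simp only [map_mul, map_pow, hU] at this
    refine mul_left_cancel₀ (pow_ne_zero (n₁ + n₂) hpF) ?_
    linear_combination -this
  · change algebraMap R F V' = _
    have := congrArg (algebraMap R F) hV'
    simp only [map_mul, map_pow, hV] at this
    refine mul_left_cancel₀ (pow_ne_zero (n₁ + n₂) hpF) ?_
    linear_combination -this

end Quadratic

/-! ### Witt vectors as local targets: Hensel lifting and ramified extensions -/

section Witt

universe u

variable {p : ℕ} [Fact p.Prime] {k : Type u} [Field k] [CharP k p]

theorem witt_charZero : CharZero (WittVector p k) := by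
  have hp0 : (p : WittVector p k) ≠ 0 := WittVector.p_nonzero p k
  obtain ⟨q, hq⟩ := CharP.exists (WittVector p k)
  rcases CharP.char_is_prime_or_zero (WittVector p k) q with hprime | rfl
  · have hqk : (q : k) = 0 := by
      have := congrArg (WittVector.constantCoeff (p := p) (R := k))
        (CharP.cast_eq_zero (WittVector p k) q)
      simpa only [map_natCast, map_zero] using this
    have hpq : p = q := (Nat.prime_dvd_prime_iff_eq Fact.out hprime).1
      ((CharP.cast_eq_zero_iff k p q).1 hqk)
    subst hpq
    exact absurd (CharP.cast_eq_zero _ _) hp0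
  · exact CharP.charP_to_charZero _

theorem witt_prime [PerfectRing k p] : Prime (p : WittVector p k) :=
  (WittVector.irreducible p).prime

theorem witt_dvd_iff [PerfectRing k p] (x : WittVector p k) :
    (p : WittVector p k) ∣ x ↔ WittVector.constantCoeff x = 0 := by
  rw [← Ideal.mem_span_singleton, WittVector.mem_span_p_iff_coeff_zero_eq_zero]
  rfl

theorem witt_isUnit {x : WittVector p k} (hx : WittVector.constantCoeff x ≠ 0) : IsUnit x :=
  WittVector.isUnit_of_coeff_zero_ne_zero x hx

theorem witt_hensel [PerfectRing k p] {f : (WittVector p k)[X]} (hf : f.Monic) (x₀ : k)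
    (h : (f.map WittVector.constantCoeff).eval x₀ = 0)
    (h' : (f.map WittVector.constantCoeff).derivative.eval x₀ ≠ 0) :
    ∃ x, f.eval x = 0 ∧ WittVector.constantCoeff x = x₀ := by
  obtain ⟨y, rfl⟩ := WittVector.constantCoeff_surjective p x₀
  rw [eval_map_apply] at h
  rw [derivative_map, eval_map_apply] at h'
  obtain ⟨x, hx, hxy⟩ := HenselianRing.is_henselian (I := Ideal.span {(p : WittVector p k)}) f hf y
    (by rwa [Ideal.mem_span_singleton, witt_dvd_iff]) ((witt_isUnit h').map _)
  rw [Ideal.mem_span_singleton, witt_dvd_iff, map_sub, sub_eq_zero] at hxy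
  exact ⟨x, hx, hxy⟩

theorem witt_exists_root [PerfectRing k p] {n : ℕ} (hn : (n : k) ≠ 0) {y : k} (hy : y ≠ 0)
    {c : WittVector p k} (hc : y ^ n = WittVector.constantCoeff c) :
    ∃ x, x ^ n = c ∧ WittVector.constantCoeff x = y := by
  have hn0 : n ≠ 0 := by rintro rfl; simp at hn
  obtain ⟨x, hx, hxy⟩ := witt_hensel (p := p) (f := X ^ n - C c) (monic_X_pow_sub_C _ hn0) y
    (by rw [Polynomial.map_sub, Polynomial.map_pow, map_X, map_C, ← hc]; simp)
    (by
      rw [Polynomial.map_sub, Polynomial.map_pow, map_X, map_C, derivative_sub, derivative_X_pow,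
        derivative_C]
      simp [hn, hy])
  exact ⟨x, by simpa [sub_eq_zero] using hx, hxy⟩

variable [PerfectRing k p] {n : ℕ} {m : ℤ} {α : ℂ} {a : 𝓞 ℚ⟮α⟯}

theorem exists_witt_hom (hn : n ≠ 0) (hirr : Irreducible (X ^ n - C m : ℤ[X]))
    (hα : α ^ n = (m : ℂ)) (ha : (a : ℚ⟮α⟯) = IntermediateField.AdjoinSimple.gen ℚ α)
    {β : WittVector p k} (hβ : β ^ n = m) :
    ∃ φ : 𝓞 ℚ⟮α⟯ →+* WittVector p k, φ a = β := by
  have := witt_charZero (p := p) (k := k)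
  let F := FractionRing (WittVector p k)
  have : CharZero F := charZero_of_injective_algebraMap (IsFractionRing.injective (WittVector p k) F)
  refine exists_pureField_int_hom hn hirr hα (algebraMap (WittVector p k) F)
    (IsFractionRing.injective _ _) (fun b hb => ?_) hβ ha
  exact mem_range_algebraMap_of_isIntegral_int hb

theorem exists_quadratic_witt_hom (hn : n ≠ 0) (hirr : Irreducible (X ^ n - C m : ℤ[X]))
    (hα : α ^ n = (m : ℂ)) (ha : (a : ℚ⟮α⟯) = IntermediateField.AdjoinSimple.gen ℚ α)
    {q b' c d : WittVector p k} (hq : WittVector.constantCoeff q ≠ 0) (hc : c = p * q)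
    (hd : d = p * b')
    {β : QuadraticAlgebra (WittVector p k) c d} (hβ : β ^ n = m) :
    ∃ φ : 𝓞 ℚ⟮α⟯ →+* QuadraticAlgebra (WittVector p k) c d, φ a = β := by
  have := witt_charZero (p := p) (k := k)
  let F := FractionRing (WittVector p k)
  have hinj := IsFractionRing.injective (WittVector p k) F
  have : CharZero F := charZero_of_injective_algebraMap hinj
  refine exists_pureField_int_hom hn hirr hα (quadraticMap F)
    (quadraticMap_injective hinj) (fun b hb => ?_) hβ ha
  refine mem_range_quadraticMap_of_isIntegral witt_prime (mt (witt_dvd_iff q).1 hq) (fun s hs => ?_)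
    hc hd b hb
  obtain ⟨r, u, rfl⟩ := WittVector.exists_eq_pow_p_mul' s hs
  exact ⟨r, (Units.mul_right_dvd).2 dvd_rfl⟩

/-- The ramified quadratic extension of the Witt vectors generated by a root `y` of
`Y ^ 2 = p * b * Y + p * q`, together with its residue map and its universal property for pure
fields. -/
theorem exists_ramified_witt_extension (hn : n ≠ 0) (hirr : Irreducible (X ^ n - C m : ℤ[X]))
    (hα : α ^ n = (m : ℂ)) (ha : (a : ℚ⟮α⟯) = IntermediateField.AdjoinSimple.gen ℚ α)
    {q : WittVector p k} (b : WittVector p k) (hq : WittVector.constantCoeff q ≠ 0) :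
    ∃ (A : Type u) (_ : CommRing A) (ι : WittVector p k →+* A) (y : A) (ρ : A →+* k),
      y ^ 2 = p * ι q + p * ι b * y ∧ (∀ x, ρ (ι x) = WittVector.constantCoeff x) ∧ ρ y = 0 ∧
      (∀ x x' : A, p * x = p * x' → x = x') ∧
      ∀ β : A, β ^ n = m → ∃ φ : 𝓞 ℚ⟮α⟯ →+* A, φ a = β := by
  have h0 : WittVector.constantCoeff (p * q : WittVector p k) = 0 :=
    (witt_dvd_iff _).1 (dvd_mul_right _ _)
  refine ⟨QuadraticAlgebra (WittVector p k) (p * q) (p * b), inferInstance,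
    algebraMap (WittVector p k) _, QuadraticAlgebra.omega,
    quadraticResidue WittVector.constantCoeff h0, ?_, quadraticResidue_algebraMap _ h0,
    quadraticResidue_omega _ h0, ?_, ?_⟩
  · rw [pow_two, QuadraticAlgebra.omega_mul_omega_eq_add, Algebra.smul_def, Algebra.smul_def,
      map_mul, map_mul, map_natCast, mul_one]
  · exact fun x x' h => quadratic_natCast_mul_left_cancel witt_prime.ne_zero h
  · intro β hβ
    exact exists_quadratic_witt_hom hn hirr hα ha hq rfl rfl hβ

end Witt

/-! ### Residue homomorphisms at 2 -/

section Two

theorem exists_sq_add_self_eq_intCast {k : Type*} [Field k] [CharP k 2] {w : k}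
    (hw : w ^ 2 + w + 1 = 0) (t : ℤ) : ∃ z : k, z ^ 2 + z = t := by
  have h2 : (2 : k) = 0 := CharTwo.two_eq_zero
  rcases Int.even_or_odd' t with ⟨r, rfl | rfl⟩
  · exact ⟨0, by push_cast; linear_combination -(r : k) * h2⟩
  · exact ⟨w, by push_cast; linear_combination hw - (r + 1 : k) * h2⟩

variable {k : Type*} [Field k] [CharP k 2] [PerfectRing k 2] {m t : ℤ}

/-- Let `c` be the cube root of `m` with residue 1. Then `c - 1 = (m - 1)/(c² + c + 1) = 4tu`, and
`(1 + 2z)² = c` reduces to `z² + z = tu`, which Hensel's lemma solves above either root `z₀`. -/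
theorem exists_witt_sq_pow_six (hm : m = 1 + 4 * t) {z₀ : k} (hz₀ : z₀ ^ 2 + z₀ = t) :
    ∃ z u : WittVector 2 k, WittVector.constantCoeff z = z₀ ∧ WittVector.constantCoeff u = 1 ∧
      z ^ 2 + z = t * u ∧ (1 + 2 * z) ^ 6 = m := by
  have h2 : (2 : k) = 0 := CharTwo.two_eq_zero
  have hmk : (m : k) = 1 := by rw [hm]; push_cast; linear_combination (2 * (t : k)) * h2
  obtain ⟨c, hc, hc1⟩ := witt_exists_root (p := 2) (n := 3) (y := (1 : k))
    (c := (m : WittVector 2 k))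
    (by push_cast; intro h3; apply one_ne_zero (α := k); linear_combination h3 - h2)
    one_ne_zero (by rw [map_intCast, hmk, one_pow])
  obtain ⟨u, hu⟩ := witt_isUnit (p := 2) (x := c ^ 2 + c + 1) (by
    simp only [map_add, map_pow, map_one, hc1]
    intro h3; apply one_ne_zero (α := k); linear_combination h3 - h2)
  have huinv : (u : WittVector 2 k) * ↑u⁻¹ = 1 := u.mul_inv
  have hu1 : WittVector.constantCoeff (↑u⁻¹ : WittVector 2 k) = 1 := by
    have := congrArg WittVector.constantCoeff huinv
    simp only [hu, map_mul, map_add, map_pow, map_one, hc1] at this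
    linear_combination this - WittVector.constantCoeff (↑u⁻¹ : WittVector 2 k) * h2
  have hcu : c = 1 + 4 * (t * ↑u⁻¹) := by
    rw [hm] at hc
    push_cast at hc
    rw [hu] at huinv
    linear_combination (1 - c) * huinv + ↑u⁻¹ * hc
  obtain ⟨z, hz, hz1⟩ := witt_hensel (p := 2)
    (f := X ^ 2 + X - C (t * ↑u⁻¹ : WittVector 2 k)) (by monicity!) z₀
    (by simp [hu1, hz₀]) (by simp [one_add_one_eq_two, h2])
  simp only [eval_sub, eval_add, eval_pow, eval_X, eval_C] at hz
  refine ⟨z, ↑u⁻¹, hz1, hu1, by linear_combination hz, ?_⟩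
  have hs : (1 + 2 * z) ^ 2 = c := by rw [hcu]; linear_combination 4 * hz
  rw [← hc, ← hs]; ring

/-- It remains to extract a square root of `1 + 2z` and twist it by the Teichmüller lift of `w`, a
cube root of unity. The residue `z₀` decides whether that square root is sought in `W(k)` or in a
ramified extension. -/
theorem exists_residue_hom_two (hm : m = 1 + 4 * t) (hirr : Irreducible (X ^ 12 - C m : ℤ[X]))
    {α : ℂ} (hα : α ^ 12 = (m : ℂ)) {a e : 𝓞 ℚ⟮α⟯}
    (ha : (a : ℚ⟮α⟯) = IntermediateField.AdjoinSimple.gen ℚ α) (he : 2 * e = 1 + a ^ 6)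
    {w z₀ : k} (hw : w ^ 2 + w + 1 = 0) (hz₀ : z₀ ^ 2 + z₀ = t) :
    ∃ φ : 𝓞 ℚ⟮α⟯ →+* k, φ a = w ∧ φ e = 1 + z₀ := by
  have h2 : (2 : k) = 0 := CharTwo.two_eq_zero
  have hW0 := witt_charZero (p := 2) (k := k)
  obtain ⟨z, u, hz, hu, hzu, hz6⟩ := exists_witt_sq_pow_six hm hz₀
  let τ : WittVector 2 k := WittVector.teichmuller 2 w
  have hτ0 : WittVector.constantCoeff τ = w := WittVector.teichmuller_coeff_zero 2 w
  have hτ3 : τ ^ 3 = 1 := by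
    rw [← map_pow, show w ^ 3 = 1 by linear_combination (w - 1) * hw, map_one]
  by_cases h0 : z₀ = 0
  -- Now `1 + 2z = 1 + 4x` has square root `1 + 2v` once `v² + v = x`. The residue of `x` lies in
  -- `F_2`, so this is solvable because `k` contains `w`.
  · obtain ⟨x, hx⟩ := (witt_dvd_iff (p := 2) z).2 (by rw [hz, h0])
    push_cast at hx
    subst hx
    obtain ⟨t', rfl⟩ : (2 : ℤ) ∣ t := by
      have := (CharP.intCast_eq_zero_iff k 2 t).1 (by rw [← hz₀, h0]; ring)
      exact_mod_cast this
    have hxt : x * (2 * x + 1) = t' * u := by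
      apply mul_left_cancel₀ (two_ne_zero (α := WittVector 2 k))
      push_cast at hzu
      linear_combination hzu
    have hx0 : WittVector.constantCoeff x = t' := by
      have := congrArg WittVector.constantCoeff hxt
      simp only [map_mul, map_add, map_one, map_ofNat, map_intCast, hu] at this
      linear_combination this - WittVector.constantCoeff x ^ 2 * h2
    obtain ⟨v₀, hv₀⟩ := exists_sq_add_self_eq_intCast hw t'
    obtain ⟨v, hv, -⟩ := witt_hensel (p := 2) (f := X ^ 2 + X - C x) (by monicity!) v₀
      (by simpa [sub_eq_zero, hx0] using hv₀) (by simp [one_add_one_eq_two, h2])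
    simp only [eval_sub, eval_add, eval_pow, eval_X, eval_C] at hv
    have hs : (1 + 2 * v) ^ 2 = 1 + 2 * (2 * x) := by linear_combination 4 * hv
    obtain ⟨φ, hφ⟩ := exists_witt_hom (p := 2) (k := k) (by norm_num) hirr hα ha
      (β := τ * (1 + 2 * v)) (by
        calc (τ * (1 + 2 * v)) ^ 12 = (τ ^ 3) ^ 4 * ((1 + 2 * v) ^ 2) ^ 6 := by ring
          _ = _ := by rw [hτ3, hs, hz6]; ring)
    refine ⟨WittVector.constantCoeff.comp φ, ?_, ?_⟩
    · simp only [RingHom.comp_apply, hφ, map_mul, map_add, map_one, map_ofNat, hτ0, h2]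
      ring
    · have h6 : φ e = 1 + 2 * (3 * x + 12 * x ^ 2 + 16 * x ^ 3) := by
        have := congrArg φ he
        simp only [map_mul, map_add, map_pow, map_one, map_ofNat, hφ] at this
        have h' : (τ * (1 + 2 * v)) ^ 6 = (1 + 2 * (2 * x)) ^ 3 := by
          calc (τ * (1 + 2 * v)) ^ 6 = (τ ^ 3) ^ 2 * ((1 + 2 * v) ^ 2) ^ 3 := by ring
            _ = _ := by rw [hτ3, hs]; ring
        apply mul_left_cancel₀ (two_ne_zero (α := WittVector 2 k))
        linear_combination this + h'
      rw [RingHom.comp_apply, h6, h0]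
      simp only [map_add, map_mul, map_one, map_ofNat, h2]
      ring
  -- Here `z` is a unit, so `Y² + 2Y - 2z` is Eisenstein, and `1 + y` is a square root of `1 + 2z`.
  · obtain ⟨A, _, ι, y, ρ, hy, hρ, hρy, hcancel, hlift⟩ :=
      exists_ramified_witt_extension (p := 2) (k := k) (n := 12) (by norm_num) hirr hα ha
        (q := z) (-1) (by rwa [hz])
    push_cast at hy hcancel
    have hs : (1 + y) ^ 2 = 1 + 2 * ι z := by
      rw [map_neg, map_one] at hy
      linear_combination hy
    have hτ3' : (ι τ) ^ 3 = 1 := by rw [← map_pow, hτ3, map_one]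
    have hz6' : (1 + 2 * ι z) ^ 6 = m := by
      simpa [map_ofNat ι 2] using congrArg ι hz6
    obtain ⟨φ, hφ⟩ := hlift (ι τ * (1 + y)) (by
      calc (ι τ * (1 + y)) ^ 12 = ((ι τ) ^ 3) ^ 4 * ((1 + y) ^ 2) ^ 6 := by ring
        _ = _ := by rw [hτ3', hs, hz6']; ring)
    refine ⟨ρ.comp φ, ?_, ?_⟩
    · simp only [RingHom.comp_apply, hφ, map_mul, map_add, map_one, hρ, hρy, hτ0]
      ring
    · have h6 : φ e = 1 + 3 * ι z + 6 * ι z ^ 2 + 4 * ι z ^ 3 := by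
        have := congrArg φ he
        simp only [map_mul, map_add, map_pow, map_one, map_ofNat, hφ] at this
        have h' : (ι τ * (1 + y)) ^ 6 = (1 + 2 * ι z) ^ 3 := by
          calc (ι τ * (1 + y)) ^ 6 = ((ι τ) ^ 3) ^ 2 * ((1 + y) ^ 2) ^ 3 := by ring
            _ = _ := by rw [hτ3', hs]; ring
        apply hcancel
        linear_combination this + h'
      rw [RingHom.comp_apply, h6]
      simp only [map_mul, map_add, map_pow, map_one, map_ofNat, hρ, hz]
      linear_combination (z₀ + 3 * z₀ ^ 2 + 2 * z₀ ^ 3) * h2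

end Two

/-! ### Residue homomorphisms at 3 -/

section Three

variable {k : Type*} [Field k] [CharP k 3] [PerfectRing k 3] {m ε t : ℤ}

/-- The equation for `r` is `r + 3r² + 3r³ = t`, which is not monic. Substituting `r = t/e` gives a
monic cubic reducing to `X³ - X²`, with simple root 1. -/
theorem exists_witt_cube_root (t : WittVector 3 k) :
    ∃ r : WittVector 3 k, (1 + 3 * r) ^ 3 = 1 + 9 * t := by
  have h3 : (3 : k) = 0 := by exact_mod_cast CharP.cast_eq_zero k 3
  have hc3 (r : WittVector 3 k) : WittVector.constantCoeff (3 * r) = 0 := by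
    rw [map_mul, map_ofNat, h3, zero_mul]
  obtain ⟨e, he, he1⟩ : ∃ e : WittVector 3 k, e ^ 3 - e ^ 2 - 3 * t * e - 3 * t ^ 2 = 0 ∧
      WittVector.constantCoeff e = 1 := by
    have h₁ := hc3 t
    have h₂ := hc3 (t ^ 2)
    generalize (3 * t : WittVector 3 k) = b₁ at h₁ ⊢
    generalize (3 * t ^ 2 : WittVector 3 k) = b₂ at h₂ ⊢
    obtain ⟨e, he, he1⟩ := witt_hensel (p := 3) (f := X ^ 3 - X ^ 2 - C b₁ * X - C b₂)
      (by monicity!) (1 : k)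
      (by simp [h₁, h₂, -WittVector.constantCoeff_apply])
      (by
        simp only [Polynomial.map_sub, Polynomial.map_mul, Polynomial.map_pow, map_X, map_C, h₁, h₂,
          map_zero, zero_mul, sub_zero, derivative_sub, derivative_X_pow, eval_sub, eval_mul,
          eval_C, eval_pow, eval_X, one_pow, mul_one]
        push_cast
        intro h; apply one_ne_zero (α := k); linear_combination h)
    exact ⟨e, by simpa using he, he1⟩
  obtain ⟨u, hu⟩ := (witt_isUnit (p := 3) (x := e) (by rw [he1]; exact one_ne_zero)).exists_right_inv
  refine ⟨t * u, ?_⟩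
  linear_combination -9 * t * u ^ 3 * he + 9 * t * ((e * u) ^ 2 + e * u + 1 - (e * u + 1) * u -
    3 * t * u ^ 2) * hu

theorem exists_witt_fourth_root (hε : ε ^ 2 = 1) {y : k} (hy : y ^ 4 = ε) (r : WittVector 3 k) :
    ∃ x : WittVector 3 k, x ^ 4 = ε * (1 + 3 * r) ∧ WittVector.constantCoeff x = y := by
  have h3 : (3 : k) = 0 := by exact_mod_cast CharP.cast_eq_zero k 3
  have hεk : (ε : k) ^ 2 = 1 := by exact_mod_cast congrArg (Int.cast (R := k)) hε
  have hy0 : y ≠ 0 := by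
    rintro rfl
    have : (ε : k) = 0 := by rw [← hy]; ring
    rw [this] at hεk
    simp at hεk
  refine witt_exists_root (p := 3) ?_ hy0 ?_
  · push_cast
    intro h; apply one_ne_zero (α := k); linear_combination h - h3
  · rw [hy, map_mul, map_intCast, map_add, map_one, map_mul, map_ofNat, h3]
    ring

theorem exists_residue_homs_three (hε : ε ^ 2 = 1) (hm : m = ε * (1 + 9 * t))
    (hirr : Irreducible (X ^ 12 - C m : ℤ[X])) {α : ℂ} (hα : α ^ 12 = (m : ℂ)) {a e : 𝓞 ℚ⟮α⟯}
    (ha : (a : ℚ⟮α⟯) = IntermediateField.AdjoinSimple.gen ℚ α)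
    (he : 3 * e = 1 + ε * a ^ 4 + a ^ 8) {y : k} (hy : y ^ 4 = ε) (i : Fin 2) :
    ∃ φ : 𝓞 ℚ⟮α⟯ →+* k, φ a = y ∧ φ e = (i : ℕ) := by
  have h3 : (3 : k) = 0 := by exact_mod_cast CharP.cast_eq_zero k 3
  have hW0 := witt_charZero (p := 3) (k := k)
  obtain ⟨r, hr3⟩ := exists_witt_cube_root (k := k) t
  obtain ⟨x, hx4, hxy⟩ := exists_witt_fourth_root hε hy r
  have hεW : (ε : WittVector 3 k) ^ 2 = 1 := by
    exact_mod_cast congrArg (Int.cast (R := WittVector 3 k)) hε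
  have hx12 : x ^ 12 = m := by
    calc x ^ 12 = (x ^ 4) ^ 3 := by ring
      _ = ε ^ 2 * ε * (1 + 3 * r) ^ 3 := by rw [hx4]; ring
      _ = m := by rw [hεW, hr3, hm]; push_cast; ring
  fin_cases i
  -- With `z² = -3 - 3z`, the element `1 + z` is a root of `X² + X + 1`. Twisting `x` by this cube
  -- root of unity keeps the residue of `a` but changes that of `e` from 1 to 0.
  · obtain ⟨A, _, ι, z, ρ, hz, hρ, hρz, hcancel, hlift⟩ :=
      exists_ramified_witt_extension (p := 3) (k := k) (n := 12) (by norm_num) hirr hα ha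
        (q := -1) (-1) (by simp [-WittVector.constantCoeff_apply])
    simp only [map_neg, map_one] at hz
    push_cast at hz hcancel
    have hz3 : (1 + z) ^ 3 = 1 := by linear_combination z * hz
    have hx4' : ι x ^ 4 = ε * (1 + 3 * ι r) := by
      simpa [map_ofNat ι 3] using congrArg ι hx4
    have hεA : (ε : A) ^ 2 = 1 := by simpa using congrArg ι hεW
    obtain ⟨φ, hφ⟩ := hlift (ι x * (1 + z)) (by
      calc (ι x * (1 + z)) ^ 12 = ι (x ^ 12) * ((1 + z) ^ 3) ^ 4 := by rw [map_pow]; ring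
        _ = (m : A) := by rw [hz3, hx12, map_intCast]; ring)
    refine ⟨ρ.comp φ, ?_, ?_⟩
    · simp only [RingHom.comp_apply, hφ, map_mul, map_add, map_one, hρ, hρz, hxy]
      ring
    · have hE : φ e = ι r * (1 + z) + (2 * ι r + 3 * ι r ^ 2) * (1 + z) ^ 2 := by
        have := congrArg φ he
        simp only [map_mul, map_add, map_pow, map_one, map_ofNat, map_intCast, hφ] at this
        have h4 : (ι x * (1 + z)) ^ 4 = ε * (1 + 3 * ι r) * (1 + z) := by
          calc (ι x * (1 + z)) ^ 4 = ι x ^ 4 * (1 + z) ^ 3 * (1 + z) := by ring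
            _ = _ := by rw [hx4', hz3]; ring
        have h8 : (ι x * (1 + z)) ^ 8 = (1 + 3 * ι r) ^ 2 * (1 + z) ^ 2 := by
          calc (ι x * (1 + z)) ^ 8 = ((ι x * (1 + z)) ^ 4) ^ 2 := by ring
            _ = ε ^ 2 * (1 + 3 * ι r) ^ 2 * (1 + z) ^ 2 := by rw [h4]; ring
            _ = _ := by rw [hεA]; ring
        apply hcancel
        rw [h4, h8] at this
        linear_combination this + (1 + 3 * ι r) * (1 + z) * hεA + hz
      rw [RingHom.comp_apply, hE]
      simp only [map_mul, map_add, map_pow, map_one, map_ofNat, hρ, hρz, h3]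
      rw [Nat.cast_zero]
      linear_combination WittVector.constantCoeff r * h3
  · obtain ⟨φ, hφ⟩ := exists_witt_hom (p := 3) (k := k) (by norm_num) hirr hα ha hx12
    refine ⟨WittVector.constantCoeff.comp φ, by rw [RingHom.comp_apply, hφ, hxy], ?_⟩
    have hE : φ e = 1 + 3 * (r + r ^ 2) := by
      have := congrArg φ he
      simp only [map_mul, map_add, map_pow, map_one, map_ofNat, map_intCast, hφ] at this
      have h8 : x ^ 8 = (1 + 3 * r) ^ 2 := by
        calc x ^ 8 = (x ^ 4) ^ 2 := by ring
          _ = ε ^ 2 * (1 + 3 * r) ^ 2 := by rw [hx4]; ring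
          _ = _ := by rw [hεW]; ring
      rw [hx4, h8] at this
      apply mul_left_cancel₀ (OfNat.ofNat_ne_zero 3 : (3 : WittVector 3 k) ≠ 0)
      linear_combination this + (1 + 3 * r) * hεW
    rw [RingHom.comp_apply, hE, map_add, map_mul, map_ofNat, h3]
    simp

end Three

/-! ### Monogenic rings and the auxiliary integers -/

theorem ringHom_ext_of_adjoin_eq_top {S B : Type*} [CommRing S] [CommRing B] {θ : S}
    (hθ : Algebra.adjoin ℤ {θ} = ⊤) {φ φ' : S →+* B} (h : φ θ = φ' θ) : φ = φ' := by
  have : φ.toIntAlgHom = φ'.toIntAlgHom :=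
    AlgHom.ext_of_adjoin_eq_top hθ (by simpa [Set.EqOn] using h)
  exact RingHom.ext fun x => DFunLike.congr_fun this x

theorem exists_int_of_root {K : Type*} [Field K] {x : K} {f : ℤ[X]} (hf : f.Monic)
    (hx : f.eval₂ (algebraMap ℤ K) x = 0) : ∃ e : 𝓞 K, algebraMap (𝓞 K) K e = x :=
  ⟨⟨x, f, hf, hx⟩, rfl⟩

theorem exists_int_two {m t : ℤ} (hm : m = 1 + 4 * t) {K : Type*} [Field K] [CharZero K]
    {a : 𝓞 K} (ha : a ^ 12 = m) : ∃ e : 𝓞 K, 2 * e = 1 + a ^ 6 := by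
  have haK : (a : K) ^ 12 = 1 + 4 * t := by
    have := congrArg (algebraMap (𝓞 K) K) ha
    rw [hm, map_pow, map_intCast] at this
    exact_mod_cast this
  obtain ⟨e, he⟩ := exists_int_of_root (x := (1 + (a : K) ^ 6) / 2) (f := X ^ 2 - X - C t)
      (by monicity!) (by
    simp only [eval₂_sub, eval₂_X_pow, eval₂_X, eval₂_C]
    rw [eq_intCast]
    linear_combination haK / 4)
  refine ⟨e, RingOfIntegers.coe_injective ?_⟩
  rw [map_mul, map_ofNat, he]
  simp only [map_add, map_pow, map_one]
  ring

/-- For `g = ε a^4` one has `g³ = 1 + 9t`, and then `(1 + g + g²)/3` is a root of `X³ - X² - 3tX -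
3t²`. -/
theorem exists_int_three {m ε t : ℤ} (hε : ε ^ 2 = 1) (hm : m = ε * (1 + 9 * t)) {K : Type*}
    [Field K] [CharZero K] {a : 𝓞 K} (ha : a ^ 12 = m) :
    ∃ e : 𝓞 K, 3 * e = 1 + ε * a ^ 4 + a ^ 8 := by
  have hεK : (ε : K) ^ 2 = 1 := by exact_mod_cast congrArg (Int.cast (R := K)) hε
  have hg : (ε * (a : K) ^ 4) ^ 3 = 1 + 9 * t := by
    have := congrArg (algebraMap (𝓞 K) K) ha
    rw [hm] at this
    simp only [map_pow, map_intCast] at this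
    push_cast at this
    linear_combination (ε : K) ^ 3 * this + ((ε : K) ^ 2 + 1) * (1 + 9 * t) * hεK
  have ha8 : (a : K) ^ 8 = (ε * (a : K) ^ 4) ^ 2 := by linear_combination -(a : K) ^ 8 * hεK
  obtain ⟨e, he⟩ := exists_int_of_root (x := (1 + ε * (a : K) ^ 4 + (a : K) ^ 8) / 3)
      (f := X ^ 3 - X ^ 2 - C (3 * t) * X - C (3 * t ^ 2)) (by monicity!) (by
    rw [ha8]
    generalize (ε * (a : K) ^ 4) = g at hg
    simp only [eval₂_sub, eval₂_mul, eval₂_X_pow, eval₂_X, eval₂_C]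
    rw [eq_intCast, eq_intCast]
    push_cast
    have ht : (t : K) = (g ^ 3 - 1) / 9 := by rw [hg]; ring
    rw [ht]
    ring)
  refine ⟨e, RingOfIntegers.coe_injective ?_⟩
  rw [map_mul, map_ofNat, he]
  simp only [map_add, map_mul, map_pow, map_one, map_intCast]
  ring

/-! ### Contradictions by counting residue homomorphisms -/

theorem adjoin_ne_top_of_one_mod_four {m t : ℤ} (hm : m = 1 + 4 * t)
    (hirr : Irreducible (X ^ 12 - C m : ℤ[X])) {α : ℂ} (hα : α ^ 12 = (m : ℂ)) (θ : 𝓞 ℚ⟮α⟯) :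
    Algebra.adjoin ℤ {θ} ≠ ⊤ := by
  classical
  intro hθ
  obtain ⟨a, ha, ha12⟩ := exists_pureField_int (by norm_num) hα
  obtain ⟨e, he⟩ := exists_int_two hm ha12
  let k := GaloisField 2 2
  have h2 : (2 : k) = 0 := CharTwo.two_eq_zero
  have : Fintype k := Fintype.ofFinite k
  have hcard : Fintype.card k = 4 := by
    rw [← Nat.card_eq_fintype_card, GaloisField.card 2 2 (by norm_num)]; norm_num
  have hroot {x : k} (hx : x ^ 2 ≠ x) : x ^ 2 + x + 1 = 0 := by
    have h4 := FiniteField.pow_card x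
    rw [hcard] at h4
    apply mul_left_cancel₀ (sub_ne_zero.2 hx)
    linear_combination h4
  obtain ⟨w, hw⟩ : ∃ w : k, w ^ 2 ≠ w := by
    by_contra! h
    have hsub : (Finset.univ : Finset k) ⊆ {0, 1} := fun x _ => by
      have : x * (x - 1) = 0 := by linear_combination h x
      rcases mul_eq_zero.1 this with hx | hx
      · simp [hx]
      · simp [sub_eq_zero.1 hx]
    have := (Finset.card_le_card hsub).trans Finset.card_le_two
    rw [Finset.card_univ, hcard] at this
    omega
  have hw1 := hroot hw
  obtain ⟨z, hz⟩ := exists_sq_add_self_eq_intCast hw1 t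
  obtain ⟨φ, hφa, hφe⟩ := exists_residue_hom_two hm hirr hα ha he hw1 hz
  -- In characteristic 2 the other root of `Z² + Z = t` is `z + 1`, so `φ` and `φ'` agree at `a` but
  -- not at `e`.
  obtain ⟨φ', hφa', hφe'⟩ := exists_residue_hom_two hm hirr hα ha he hw1
    (z₀ := z + 1) (by linear_combination hz + (z + 1) * h2)
  have hne {ψ : 𝓞 ℚ⟮α⟯ →+* k} (hψ : ψ a = w) : ψ θ ^ 2 ≠ ψ θ := by
    intro h
    have := ringHom_ext_of_adjoin_eq_top hθ (φ := (frobenius k 2).comp ψ) (φ' := ψ) h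
    have := DFunLike.congr_fun this a
    rw [RingHom.comp_apply, hψ, frobenius_def] at this
    exact hw this
  have hx := hroot (hne hφa)
  have hx' := hroot (hne hφa')
  -- Both values are roots of `X² + X + 1`, whose roots are `φ θ` and its Frobenius conjugate.
  have hprod : (φ' θ - φ θ) * (φ' θ - φ θ ^ 2) = 0 := by
    linear_combination hx' + (φ θ - φ' θ - 1) * hx
  rcases mul_eq_zero.1 hprod with h | h
  · have := ringHom_ext_of_adjoin_eq_top hθ (sub_eq_zero.1 h)
    rw [this, hφe] at hφe'
    exact one_ne_zero (α := k) (by linear_combination -hφe')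
  · have := ringHom_ext_of_adjoin_eq_top hθ (φ := φ') (φ' := (frobenius k 2).comp φ)
      (sub_eq_zero.1 h)
    have := DFunLike.congr_fun this a
    rw [RingHom.comp_apply, hφa, hφa', frobenius_def] at this
    exact hw this.symm

/-- If `𝓞 K = ℤ[θ]` then the residue homomorphisms constructed at `3` are separated by their values
at `θ`. -/
theorem two_mul_card_le_of_adjoin_eq_top {k : Type*} [Field k] [CharP k 3] [Fintype k]
    [DecidableEq k] {m ε t : ℤ} (hε : ε ^ 2 = 1) (hm : m = ε * (1 + 9 * t))
    (hirr : Irreducible (X ^ 12 - C m : ℤ[X])) {α : ℂ} (hα : α ^ 12 = (m : ℂ)) {θ : 𝓞 ℚ⟮α⟯}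
    (hθ : Algebra.adjoin ℤ {θ} = ⊤) (S T : Finset k) (hS : ∀ y ∈ S, y ^ 4 = ε)
    (hT : ∀ (a : 𝓞 ℚ⟮α⟯) (φ : 𝓞 ℚ⟮α⟯ →+* k), φ a ∈ S → φ θ ∈ T) :
    2 * S.card ≤ T.card := by
  obtain ⟨a, ha, ha12⟩ := exists_pureField_int (by norm_num) hα
  obtain ⟨e, he⟩ := exists_int_three hε hm ha12
  have h (q : S × Fin 2) : ∃ φ : 𝓞 ℚ⟮α⟯ →+* k, φ a = q.1 ∧ φ e = (q.2 : ℕ) :=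
    exists_residue_homs_three hε hm hirr hα ha he (hS q.1 q.1.2) q.2
  choose φ hφa hφe using h
  have := Finset.card_le_card_of_injOn (s := (Finset.univ : Finset (S × Fin 2))) (t := T)
    (fun q => φ q θ) ?_ ?_
  · simpa [mul_comm] using this
  · exact fun q _ => hT a _ (by rw [hφa]; exact q.1.2)
  · intro q _ q' _ heq
    have hφφ : φ q = φ q' := ringHom_ext_of_adjoin_eq_top hθ heq
    have h1 : q.1 = q'.1 := Subtype.ext (by rw [← hφa, ← hφa, hφφ])
    have h2 : ((q.2 : ℕ) : k) = (q'.2 : ℕ) := by rw [← hφe, ← hφe, hφφ]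
    refine Prod.ext h1 ?_
    generalize q.2 = i, q'.2 = i' at h2
    fin_cases i <;> fin_cases i' <;> simp_all

theorem adjoin_ne_top_of_one_mod_nine {m t : ℤ} (hm : m = 1 * (1 + 9 * t))
    (hirr : Irreducible (X ^ 12 - C m : ℤ[X])) {α : ℂ} (hα : α ^ 12 = (m : ℂ)) (θ : 𝓞 ℚ⟮α⟯) :
    Algebra.adjoin ℤ {θ} ≠ ⊤ := by
  intro hθ
  -- Both units of `F_3` are fourth roots of 1, so the bound reads `4 ≤ 3`.
  have := two_mul_card_le_of_adjoin_eq_top (k := ZMod 3) (by norm_num) hm hirr hα hθ {1, 2}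
    Finset.univ (by decide) (fun _ _ _ => Finset.mem_univ _)
  revert this
  decide

theorem adjoin_ne_top_of_neg_one_mod_nine {m t : ℤ} (hm : m = -1 * (1 + 9 * t))
    (hirr : Irreducible (X ^ 12 - C m : ℤ[X])) {α : ℂ} (hα : α ^ 12 = (m : ℂ)) (θ : 𝓞 ℚ⟮α⟯) :
    Algebra.adjoin ℤ {θ} ≠ ⊤ := by
  classical
  intro hθ
  let k := GaloisField 3 2
  have : Fintype k := Fintype.ofFinite k
  have hcard : Fintype.card k = 9 := by
    rw [← Nat.card_eq_fintype_card, GaloisField.card 3 2 (by norm_num)]; norm_num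
  have h3 : (3 : k) = 0 := by exact_mod_cast CharP.cast_eq_zero k 3
  have h20 : (-1 : k) ≠ 1 := fun h => one_ne_zero (α := k) (by linear_combination h3 + h)
  have key := two_mul_card_le_of_adjoin_eq_top (k := k) (by norm_num) hm hirr hα hθ
    (Finset.univ.filter fun y => y ^ 4 = -1) (Finset.univ.filter fun x => ¬ x ^ 3 = x)
    (by simp) (fun a φ ha => by
      simp only [Finset.mem_filter, Finset.mem_univ, true_and] at ha ⊢
      intro h
      have := ringHom_ext_of_adjoin_eq_top hθ (φ := (frobenius k 3).comp φ) (φ' := φ) h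
      have h' : φ a ^ 3 = φ a := DFunLike.congr_fun this a
      have h2 : φ a ^ 2 = -1 := by linear_combination ha - φ a * h'
      have h4 : φ a ^ 4 = 1 := by linear_combination (φ a ^ 2 - 1) * h2
      exact h20 (ha.symm.trans h4))
  have hfix : 3 ≤ (Finset.univ.filter fun x : k => x ^ 3 = x).card := by
    have hsub : ({0, 1, -1} : Finset k) ⊆ Finset.univ.filter fun x : k => x ^ 3 = x := by
      intro x hx
      simp only [Finset.mem_insert, Finset.mem_singleton] at hx
      rcases hx with rfl | rfl | rfl <;> simp
      ring
    refine le_trans ?_ (Finset.card_le_card hsub)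
    rw [Finset.card_eq_three.2 ⟨0, 1, -1, zero_ne_one, by simp, h20.symm, rfl⟩]
  have hsplit := Finset.card_filter_add_card_filter_not (s := (Finset.univ : Finset k))
    (fun x : k => x ^ 3 = x)
  have hone : (Finset.univ.filter fun x : k => x ^ 4 = 1).card ≤ 4 := by
    refine le_trans (Finset.card_le_card fun x hx => ?_)
      ((Multiset.toFinset_card_le _).trans (Polynomial.card_nthRoots 4 (1 : k)))
    rw [Multiset.mem_toFinset, Polynomial.mem_nthRoots (by norm_num)]
    simpa using hx
  -- From `x^9 - x = x(x^4 - 1)(x^4 + 1)`: at most 4 roots of `x^4 = 1` leave at least 4 roots of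
  -- `x^4 = -1`.
  have hcover : (Finset.univ : Finset k) ⊆ {0} ∪ ((Finset.univ.filter fun x : k => x ^ 4 = 1) ∪
      (Finset.univ.filter fun x : k => x ^ 4 = -1)) := by
    intro x _
    simp only [Finset.mem_union, Finset.mem_singleton, Finset.mem_filter, Finset.mem_univ, true_and]
    by_cases hx : x = 0
    · exact Or.inl hx
    · right
      have h9 := FiniteField.pow_card x
      rw [hcard] at h9
      have : (x ^ 4 - 1) * (x ^ 4 + 1) = 0 := by
        apply mul_left_cancel₀ hx
        linear_combination h9
      exact (mul_eq_zero.1 this).imp sub_eq_zero.1 eq_neg_of_add_eq_zero_left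
  have hle := (Finset.card_le_card hcover).trans ((Finset.card_union_le _ _).trans
    (Nat.add_le_add_left (Finset.card_union_le _ _) _))
  rw [Finset.card_univ, hcard] at hsplit hle
  rw [Finset.card_singleton] at hle
  omega

theorem theorem2p2 (m : ℤ) (hm : Squarefree m) (hm_one : m ≠ 1) (hm_neg_one : m ≠ -1)
    (hirr : Irreducible (Polynomial.X ^ 12 - Polynomial.C m : Polynomial ℤ))
    (α : ℂ) (hα : α ^ 12 = (m : ℂ))
    (hcong : m ≡ 1 [ZMOD 4] ∨ m ≡ 1 [ZMOD 9] ∨ m ≡ -1 [ZMOD 9]) :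
    ¬ IsMonogenicField ℚ⟮α⟯ := by
  rw [isMonogenicField_iff_adjoin]
  rintro ⟨θ, hθ⟩
  rcases hcong with h | h | h
  · obtain ⟨t, ht⟩ := h.symm.dvd
    exact adjoin_ne_top_of_one_mod_four (t := t) (by linarith) hirr hα θ hθ
  · obtain ⟨t, ht⟩ := h.symm.dvd
    exact adjoin_ne_top_of_one_mod_nine (t := t) (by linarith) hirr hα θ hθ
  · obtain ⟨t, ht⟩ := h.symm.dvd
    exact adjoin_ne_top_of_neg_one_mod_nine (t := -t) (by linarith) hirr hα θ hθ
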